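/- All graphs are finite, simple and nonempty. A graph $G$ is \emph{m-decyclable} (matching-decyclable) if it has a matching $M\subseteq E(G)$ such that $G-M$ (the graph obtained by deleting the edges of $M$) is acyclic. A \emph{cograph} is a graph with no induced path on four vertices, and a graph is \emph{nontrivial} if it has at least two vertices. A \emph{square} is a chordless $4$-cycle $C_4$, a \emph{triangle} is $K_3$, and a \emph{diamond} is a $4$-cycle plus one chord. A \emph{block} of $G$ is either a bridge (together with its two ends) or a maximal $2$-connected subgraph of $G$, where a graph is $2$-connected if it is connected, has at least three vertices and has no cut vertex. An \emph{md-star} is a graph $G$ such that: (a) $G$ has exactly one cut vertex $x$; (b) at most one block of $G$ is a diamond, and every other block is a bridge or a triangle; (c) if $D$ is a diamond block of $G$, then $x$ has degree $3$ in $D$. \textbf{Corollary.} Let $G$ be a nontrivial connected cograph. Then $G$ is m-decyclable if and only if $G$ is (isomorphic to) one of the following graphs: $K_2$, a triangle, a square, a diamond, $K_{2,3}$, or $G$ is an md-star. -/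

import Mathlib

namespace MDecyclable

/-- `G` is matching-decyclable: there is a matching `M` of `G` such that `G - M`, the graph on the
same vertex set whose edges are the edges of `G` that are not in `M`, is acyclic. -/
def IsMDecyclable {V : Type*} (G : SimpleGraph V) : Prop :=
  ∃ M : G.Subgraph, M.IsMatching ∧ (G.deleteEdges M.edgeSet).IsAcyclic

/-- A cograph is a graph without an induced path on four vertices. -/
def IsCograph {V : Type*} (G : SimpleGraph V) : Prop :=
  ¬ (SimpleGraph.pathGraph 4).IsIndContained G

/-- The diamond: a 4-cycle plus one chord. -/
def diamond : SimpleGraph (Fin 4) :=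
  SimpleGraph.cycleGraph 4 ⊔ SimpleGraph.edge 0 2

/-- `x` is a cut vertex of `G`: its removal separates two vertices that `G` connects. When `G` is
connected this says that `G - x` is disconnected. -/
def IsCutVertex {V : Type*} (G : SimpleGraph V) (x : V) : Prop :=
  ∃ (u w : V) (hu : u ≠ x) (hw : w ≠ x), G.Reachable u w ∧
    ¬ (G.induce {y : V | y ≠ x}).Reachable ⟨u, hu⟩ ⟨w, hw⟩

/-- `G` is 2-connected: it is connected, has at least three vertices and has no cut vertex. -/
def IsTwoConnected {V : Type*} (G : SimpleGraph V) : Prop :=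
  3 ≤ ENat.card V ∧ G.Connected ∧ ∀ x, ¬ IsCutVertex G x

/-- The subgraph `B` of `G` consists of a single bridge of `G` and its two ends. -/
def IsBridgeSubgraph {V : Type*} {G : SimpleGraph V} (B : G.Subgraph) : Prop :=
  ∃ (u v : V) (h : G.Adj u v), G.IsBridge s(u, v) ∧ B = G.subgraphOfAdj h

/-- A block of `G` is a bridge or a maximal 2-connected subgraph of `G`. -/
def IsBlock {V : Type*} {G : SimpleGraph V} (B : G.Subgraph) : Prop :=
  IsBridgeSubgraph B ∨ Maximal (fun H : G.Subgraph => IsTwoConnected H.coe) B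

/-- A diamond block of `G`. -/
def IsDiamondBlock {V : Type*} {G : SimpleGraph V} (B : G.Subgraph) : Prop :=
  IsBlock B ∧ Nonempty (B.coe ≃g diamond)

/-- An md-star: there is exactly one cut vertex `x`; there is at most one diamond block, and every
other block is a bridge or a triangle; the degree of `x` in a diamond block is 3. -/
def IsMDStar {V : Type*} (G : SimpleGraph V) : Prop :=
  ∃ x : V, (∀ v, IsCutVertex G v ↔ v = x) ∧
    (∀ D D' : G.Subgraph, IsDiamondBlock D → IsDiamondBlock D' → D = D') ∧
    (∀ B : G.Subgraph, IsBlock B → ¬ IsDiamondBlock B →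
      IsBridgeSubgraph B ∨ Nonempty (B.coe ≃g SimpleGraph.completeGraph (Fin 3))) ∧
    (∀ D : G.Subgraph, IsDiamondBlock D → (D.neighborSet x).ncard = 3)

end MDecyclable

/-! A connected cograph with at least two vertices is a join: were the graph and its complement both
connected, neither would have a cut vertex, since a cut vertex of a connected `P_4`-free graph is
adjacent to everything (`IsCutVertex.adj`) and so isolated in the complement. Vertices could then be
deleted down to two, which is absurd.

A matching cannot destroy all cycles of `K_4`, `K_{2,4}`, `K_{3,3}`, or of `K_{2,3}` with an added
edge on either side: edge counting shows that too many edges remain for a forest, and the proofs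
exhibit a surviving cycle. If both sides of the join have two vertices, only the square, the diamond
and `K_{2,3}` escape (`IsMDecyclable.iso_of_join`).

If one side is a single vertex `x`, the exclusions say that the components of `G - x` are `K_1`,
`K_2` and at most one path on three vertices; this is `IsHub`. If `x` is no cut vertex there is one
component, so `G` is `K_2`, a triangle or a diamond. Otherwise the blocks are the components with
`x` added, and `G` is an md-star.

Conversely the cut vertex of an md-star is a hub (`IsMDStar.exists_isHub`), and a hub graph has an
explicit matching whose removal leaves a tree (`IsHub.isMDecyclable`). -/

namespace MDecyclable

open SimpleGraph

/-! ### Cographs: cut vertices and the join decomposition. -/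

/-- `G` has no four vertices `a, b, c, d` inducing the path `a - b - c - d`. -/
def PathFree {V : Type*} (G : SimpleGraph V) : Prop :=
  ∀ a b c d, G.Adj a b → G.Adj b c → G.Adj c d →
    ¬ G.Adj a c → ¬ G.Adj b d → ¬ G.Adj a d → False

theorem IsCograph.pathFree {V : Type*} {G : SimpleGraph V} (hG : IsCograph G) : PathFree G := by
  intro a b c d hab hbc hcd hac hbd had
  have h1 : a ≠ c := by rintro rfl; exact had hcd
  have h2 : b ≠ d := by rintro rfl; exact had hab
  have h3 : a ≠ d := by rintro rfl; exact hac hcd.symm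
  have := hab.ne
  have := hbc.ne
  have := hcd.ne
  refine hG ⟨⟨⟨![a, b, c, d], ?_⟩, ?_⟩⟩
  · intro i j hij
    fin_cases i <;> fin_cases j <;> simp_all
  · intro i j
    change G.Adj (![a, b, c, d] i) (![a, b, c, d] j) ↔ _
    fin_cases i <;> fin_cases j <;> simp_all [SimpleGraph.pathGraph_adj, G.adj_comm]

/-- The path is self-complementary: `a - b - c - d` in the complement is `b - d - a - c` in the
graph. -/
theorem PathFree.compl {V : Type*} {G : SimpleGraph V} (hG : PathFree G) : PathFree Gᶜ := by
  intro a b c d hab hbc hcd hac hbd had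
  have h1 : a ≠ c := by rintro rfl; exact had hcd
  have h2 : b ≠ d := by rintro rfl; exact had hab
  have h3 : a ≠ d := by rintro rfl; exact hac hcd.symm
  simp only [SimpleGraph.compl_adj] at *
  refine hG b d a c ?_ ?_ ?_ ?_ ?_ ?_ <;> grind [G.adj_comm]

theorem PathFree.induce {V : Type*} {G : SimpleGraph V} (hG : PathFree G) (s : Set V) :
    PathFree (G.induce s) :=
  fun a b c d h1 h2 h3 h4 h5 h6 => hG a b c d h1 h2 h3 h4 h5 h6

theorem exists_adj_boundary {V : Type*} {G : SimpleGraph V} {P : V → Prop} {u w : V}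
    (h : G.Reachable u w) (hu : P u) (hw : ¬ P w) :
    ∃ a b, G.Reachable u a ∧ G.Adj a b ∧ P a ∧ ¬ P b := by
  obtain ⟨p⟩ := h
  induction p with
  | nil => exact absurd hu hw
  | @cons u v w h p ih =>
    by_cases hv : P v
    · obtain ⟨a, b, h1, h2⟩ := ih hv hw
      exact ⟨a, b, h.reachable.trans h1, h2⟩
    · exact ⟨u, v, SimpleGraph.Reachable.refl u, h, hu, hv⟩

theorem exists_adj_reachable_induce {V : Type*} {G : SimpleGraph V} {x v : V} (p : G.Walk v x)
    (hv : v ≠ x) : ∃ (n : V) (hn : n ≠ x), G.Adj x n ∧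
      (G.induce {y : V | y ≠ x}).Reachable ⟨v, hv⟩ ⟨n, hn⟩ := by
  induction p with
  | nil => exact absurd rfl hv
  | @cons u v x h p ih =>
    by_cases hvx : v = x
    · subst hvx
      exact ⟨u, hv, h.symm, SimpleGraph.Reachable.refl _⟩
    · obtain ⟨n, hn, h1, h2⟩ := ih hvx
      refine ⟨n, hn, h1, SimpleGraph.Reachable.trans (SimpleGraph.Adj.reachable ?_) h2⟩
      exact h

/-- In a connected graph without induced path on four vertices a cut vertex is adjacent to all
other vertices. -/
theorem IsCutVertex.adj {V : Type*} {G : SimpleGraph V} (hconn : G.Connected) (hG : PathFree G)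
    {x y : V} (hx : IsCutVertex G x) (hy : y ≠ x) : G.Adj x y := by
  by_contra hxy
  obtain ⟨u, w, hu, hw, -, huw⟩ := hx
  obtain ⟨z, hz, hyz⟩ : ∃ (z : V) (hz : z ≠ x),
      ¬ (G.induce {y : V | y ≠ x}).Reachable ⟨y, hy⟩ ⟨z, hz⟩ := by
    by_contra! h
    exact huw ((h u hu).symm.trans (h w hw))
  obtain ⟨p⟩ := hconn z x
  obtain ⟨q⟩ := hconn y x
  obtain ⟨n, hn, hxn, hzn⟩ := exists_adj_reachable_induce p hz
  obtain ⟨m, hm, hxm, hym⟩ := exists_adj_reachable_induce q hy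
  -- In the component of `y` in `G - x` some edge `ab` leaves the neighbourhood of `x`. With a
  -- neighbour `n` of `x` from another component, `n - x - a - b` is an induced path.
  obtain ⟨a, b, h1, h2, h3, h4⟩ := exists_adj_boundary
    (P := fun v : {y : V | y ≠ x} => G.Adj x v) hym.symm hxm hxy
  have hya := hym.trans h1
  have key : ∀ c, (G.induce {y : V | y ≠ x}).Reachable ⟨y, hy⟩ c → ¬ G.Adj n c := by
    intro c hc h
    have h' : (G.induce {y : V | y ≠ x}).Adj ⟨n, hn⟩ c := h
    exact hyz (hc.trans (h'.reachable.symm.trans hzn.symm))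
  exact hG n x a b hxn.symm h3 h2 (key a hya) h4 (key b (hya.trans h2.reachable))

theorem isCutVertex_of_not_preconnected {V : Type*} {G : SimpleGraph V} (hconn : G.Connected)
    {x : V} (h : ¬ (G.induce {y : V | y ≠ x}).Preconnected) : IsCutVertex G x := by
  simp only [SimpleGraph.Preconnected, not_forall] at h
  obtain ⟨⟨u, hu⟩, ⟨w, hw⟩, h⟩ := h
  exact ⟨u, w, hu, hw, hconn u w, h⟩

/-- A cut vertex would be adjacent to all others, hence isolated in the connected complement. -/
theorem PathFree.preconnected_induce {V : Type*} [Nontrivial V] {G : SimpleGraph V}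
    (hG : PathFree G) (hconn : G.Connected) (hcompl : Gᶜ.Connected) (x : V) :
    (G.induce {y : V | y ≠ x}).Preconnected := by
  by_contra h
  have hx := isCutVertex_of_not_preconnected hconn h
  obtain ⟨y, hy⟩ := hcompl.preconnected.exists_adj_of_nontrivial x
  rw [SimpleGraph.compl_adj] at hy
  exact hy.2 (hx.adj hconn hG hy.1.symm)

/-- A finite nontrivial graph without induced path on four vertices is disconnected or has a
disconnected complement. -/
theorem PathFree.not_connected_compl {V : Type*} [Finite V] [Nontrivial V] {G : SimpleGraph V}
    (hG : PathFree G) (hconn : G.Connected) : ¬ Gᶜ.Connected := by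
  -- Deleting a vertex keeps both the graph and its complement connected. On two vertices both would
  -- have to contain the only possible edge.
  induction hn : Nat.card V using Nat.strong_induction_on generalizing V with
  | _ n ih =>
    intro hcompl
    obtain ⟨x, u, hxu⟩ := exists_pair_ne V
    by_cases hnt : Nontrivial {y : V | y ≠ x}
    · have h1 := hG.preconnected_induce hconn hcompl x
      have h2 := hG.compl.preconnected_induce hcompl (by rwa [compl_compl]) x
      have hc : (G.induce {y : V | y ≠ x})ᶜ = Gᶜ.induce {y : V | y ≠ x} := by
        ext a b
        simp [SimpleGraph.compl_adj, Subtype.ext_iff]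
      refine ih _ ?_ (hG.induce {y : V | y ≠ x}) ⟨h1⟩ rfl (by rw [hc]; exact ⟨h2⟩)
      rw [← hn]
      exact Finite.card_subtype_lt (p := fun y => y ≠ x) (x := x) (by simp)
    · have hall : ∀ y, y ≠ x → y = u := by
        intro y hy
        by_contra hyu
        exact hnt ⟨⟨y, hy⟩, ⟨u, hxu.symm⟩, by simpa using hyu⟩
      obtain ⟨y, hy⟩ := hconn.preconnected.exists_adj_of_nontrivial x
      obtain ⟨z, hz⟩ := hcompl.preconnected.exists_adj_of_nontrivial x
      rw [hall y hy.ne.symm] at hy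
      rw [hall z hz.ne.symm, SimpleGraph.compl_adj] at hz
      exact hz.2 hy

/-- A connected finite nontrivial graph without induced path on four vertices is a join. -/
theorem PathFree.exists_join {V : Type*} [Finite V] [Nontrivial V] {G : SimpleGraph V}
    (hG : PathFree G) (hconn : G.Connected) :
    ∃ A : Set V, A.Nonempty ∧ Aᶜ.Nonempty ∧ ∀ a ∈ A, ∀ b ∉ A, G.Adj a b := by
  have h := hG.not_connected_compl hconn
  rw [SimpleGraph.connected_iff] at h
  have h' : ¬ Gᶜ.Preconnected := fun hp => h ⟨hp, inferInstance⟩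
  simp only [SimpleGraph.Preconnected, not_forall] at h'
  obtain ⟨u, w, huw⟩ := h'
  -- One side of the join is a component of the complement.
  refine ⟨{v | Gᶜ.Reachable u v}, ⟨u, SimpleGraph.Reachable.refl u⟩, ⟨w, huw⟩, ?_⟩
  intro a ha b hb
  by_contra hab
  refine hb (SimpleGraph.Reachable.trans ha (SimpleGraph.Adj.reachable ?_))
  rw [SimpleGraph.compl_adj]
  exact ⟨by rintro rfl; exact hb ha, hab⟩


/-! ### Matchings as partner functions; the five small graphs. -/

/-- The graph left when the edges `s(u, v)` with `p u = v` and `p v = u` are deleted from `G`. -/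
def unmatched {V : Type*} (G : SimpleGraph V) (p : V → V) : SimpleGraph V where
  Adj u v := G.Adj u v ∧ ¬ (p u = v ∧ p v = u)
  symm := ⟨fun _ _ h => ⟨h.1.symm, fun h' => h.2 h'.symm⟩⟩
  loopless := ⟨fun _ h => G.irrefl h.1⟩

/-- Only mutual pairs `p u = v`, `p v = u` are deleted, so an arbitrary function encodes a matching
and no involution condition is needed. -/
theorem isMDecyclable_iff {V : Type*} {G : SimpleGraph V} :
    IsMDecyclable G ↔ ∃ p : V → V, (unmatched G p).IsAcyclic := by
  classical
  constructor
  · rintro ⟨M, hM, hac⟩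
    choose f hf huniq using fun v : M.verts => hM v.2
    -- The default value off `M` is harmless: it suffices that every edge of `M` becomes a mutual
    -- pair.
    refine ⟨fun v => if h : v ∈ M.verts then f ⟨v, h⟩ else v, ?_⟩
    refine hac.anti fun u v h => ?_
    rw [deleteEdges_adj, Subgraph.mem_edgeSet]
    refine ⟨h.1, fun hm => h.2 ⟨?_, ?_⟩⟩
    · simp only [hm.fst_mem, dif_pos]
      exact (huniq ⟨u, hm.fst_mem⟩ v hm).symm
    · simp only [hm.snd_mem, dif_pos]
      exact (huniq ⟨v, hm.snd_mem⟩ u hm.symm).symm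
  · rintro ⟨p, hp⟩
    refine ⟨{ verts := {v | G.Adj v (p v) ∧ p (p v) = v}
              Adj := fun u v => G.Adj u v ∧ p u = v ∧ p v = u
              adj_sub := fun h => h.1
              edge_vert := ?_
              symm := ⟨fun _ _ h => ⟨h.1.symm, h.2.2, h.2.1⟩⟩ }, ?_, ?_⟩
    · rintro u v ⟨h, rfl, h'⟩
      exact ⟨h, h'⟩
    · rintro v ⟨h, h'⟩
      exact ⟨p v, ⟨h, rfl, h'⟩, fun w hw => hw.2.1.symm⟩
    · refine hp.anti fun u v h => ?_
      rw [deleteEdges_adj, Subgraph.mem_edgeSet] at h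
      exact ⟨h.1, fun h' => h.2 ⟨h.1, h'⟩⟩

/-- A graph whose edges all join a vertex to its parent is acyclic. -/
theorem isAcyclic_of_parent {V : Type*} {G : SimpleGraph V} (parent : V → V) (rank : V → ℕ)
    (h : ∀ u v, G.Adj u v →
      (parent u = v ∧ rank v < rank u) ∨ (parent v = u ∧ rank u < rank v)) :
    G.IsAcyclic := by
  classical
  intro a c hc
  -- At a vertex of maximal rank on a cycle both cycle neighbours must be the parent, yet they are
  -- distinct.
  obtain ⟨v, hv, hmax⟩ := c.support.toFinset.exists_max_image rank ⟨a, by simp⟩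
  rw [List.mem_toFinset] at hv
  have hmax' : ∀ w ∈ c.support, rank w ≤ rank v := fun w hw => hmax w (by simpa using hw)
  have hr := hc.rotate hv
  have hmem : ∀ w ∈ (c.rotate v hv).support, rank w ≤ rank v := by
    intro w hw
    exact hmax' w (by simpa [Walk.mem_support_rotate_iff] using hw)
  have hadj1 := Walk.adj_snd hr.not_nil
  have hadj2 := Walk.adj_penultimate hr.not_nil
  have h1 := hmem _ (Walk.getVert_mem_support (c.rotate v hv) 1)
  have h2 := hmem _ (Walk.getVert_mem_support (c.rotate v hv) ((c.rotate v hv).length - 1))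
  have e1 : parent v = (c.rotate v hv).snd := by
    rcases h _ _ hadj1 with h | h
    · exact h.1
    · exact absurd h.2 (not_lt.2 h1)
  have e2 : parent v = (c.rotate v hv).penultimate := by
    rcases h _ _ hadj2 with h | h
    · exact absurd h.2 (not_lt.2 h2)
    · exact h.1
  exact hr.snd_ne_penultimate (e1.symm.trans e2)

/-- A certificate that `decide` can check on small graphs: every edge is matched or belongs to a
rooted forest. -/
theorem isMDecyclable_of_parent {V : Type*} {G : SimpleGraph V} (partner parent : V → V)
    (rank : V → ℕ)
    (h : ∀ u v, G.Adj u v → (partner u = v ∧ partner v = u) ∨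
      (parent u = v ∧ rank v < rank u) ∨ (parent v = u ∧ rank u < rank v)) :
    IsMDecyclable G :=
  isMDecyclable_iff.2 ⟨partner, isAcyclic_of_parent parent rank fun u v huv =>
    (h u v huv.1).resolve_left huv.2⟩

theorem IsMDecyclable.of_iso {V W : Type*} {G : SimpleGraph V} {K : SimpleGraph W}
    (e : G ≃g K) (h : IsMDecyclable K) : IsMDecyclable G := by
  obtain ⟨p, hp⟩ := isMDecyclable_iff.1 h
  refine isMDecyclable_iff.2 ⟨fun v => e.symm (p (e v)), ?_⟩
  refine hp.comap ⟨e, ?_⟩ e.injective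
  rintro u v ⟨h1, h2⟩
  refine ⟨e.map_adj_iff.2 h1, fun h3 => h2 ⟨?_, ?_⟩⟩
  · simp [h3.1]
  · simp [h3.2]

theorem isMDecyclable_complete_two : IsMDecyclable (completeGraph (Fin 2)) :=
  isMDecyclable_of_parent ![1, 0] ![0, 0] ![0, 0] (by decide)

theorem isMDecyclable_complete_three : IsMDecyclable (completeGraph (Fin 3)) :=
  isMDecyclable_of_parent ![1, 0, 2] ![2, 2, 2] ![1, 1, 0] (by decide)

theorem isMDecyclable_cycle_four : IsMDecyclable (cycleGraph 4) :=
  isMDecyclable_of_parent ![1, 0, 2, 3] ![3, 2, 3, 3] ![1, 2, 1, 0]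
    (by simp only [cycleGraph_adj]; decide)

theorem diamond_adj (i j : Fin 4) :
    diamond.Adj i j ↔ i ≠ j ∧ ¬ (i = 1 ∧ j = 3) ∧ ¬ (i = 3 ∧ j = 1) := by
  simp only [diamond, sup_adj, cycleGraph_adj, edge_adj]
  revert i j
  decide

theorem isMDecyclable_diamond : IsMDecyclable diamond :=
  isMDecyclable_of_parent ![1, 0, 3, 2] ![2, 2, 2, 0] ![1, 1, 0, 2]
    (by simp only [diamond_adj]; decide)

theorem isMDecyclable_completeBipartite :
    IsMDecyclable (completeBipartiteGraph (Fin 2) (Fin 3)) :=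
  isMDecyclable_of_parent
    (Sum.elim ![.inr 0, .inr 1] ![.inl 0, .inl 1, .inr 2])
    (Sum.elim ![.inr 2, .inr 2] ![.inl 1, .inl 0, .inr 2])
    (Sum.elim ![1, 1] ![2, 2, 0])
    (by simp only [completeBipartiteGraph_adj]
        rintro (i | i) (j | j) <;> revert i j <;> decide)

/-! ### Short cycles contradicting acyclicity. -/

section Cycles
variable {V : Type*} {R : SimpleGraph V}

theorem _root_.SimpleGraph.IsAcyclic.no_three (h : R.IsAcyclic) {a b c : V} (h1 : R.Adj a b)
    (h2 : R.Adj b c) (h3 : R.Adj c a) : False := by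
  have := h1.ne; have := h2.ne; have := h3.ne
  refine h (.cons h1 (.cons h2 (.cons h3 .nil))) ?_
  simp only [Walk.cons_isCycle_iff, Walk.cons_isPath_iff, Walk.edges_cons, Walk.edges_nil,
    Walk.support_cons, Walk.support_nil, List.mem_cons, List.not_mem_nil, or_false, not_or,
    Walk.IsPath.nil, Sym2.eq_iff]
  grind

theorem _root_.SimpleGraph.IsAcyclic.no_four (h : R.IsAcyclic) {a b c d : V} (h1 : R.Adj a b)
    (h2 : R.Adj b c) (h3 : R.Adj c d) (h4 : R.Adj d a) (hac : a ≠ c) (hbd : b ≠ d) : False := by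
  have := h1.ne; have := h2.ne; have := h3.ne; have := h4.ne
  refine h (.cons h1 (.cons h2 (.cons h3 (.cons h4 .nil)))) ?_
  simp only [Walk.cons_isCycle_iff, Walk.cons_isPath_iff, Walk.edges_cons, Walk.edges_nil,
    Walk.support_cons, Walk.support_nil, List.mem_cons, List.not_mem_nil, or_false, not_or,
    Walk.IsPath.nil, Sym2.eq_iff]
  grind

theorem _root_.SimpleGraph.IsAcyclic.no_five (h : R.IsAcyclic) {a b c d e : V} (h1 : R.Adj a b)
    (h2 : R.Adj b c) (h3 : R.Adj c d) (h4 : R.Adj d e) (h5 : R.Adj e a)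
    (hn : [a, b, c, d, e].Nodup) : False := by
  refine h (.cons h1 (.cons h2 (.cons h3 (.cons h4 (.cons h5 .nil))))) ?_
  simp only [List.nodup_cons, List.mem_cons, List.not_mem_nil, or_false, not_or] at hn
  simp only [Walk.cons_isCycle_iff, Walk.cons_isPath_iff, Walk.edges_cons, Walk.edges_nil,
    Walk.support_cons, Walk.support_nil, List.mem_cons, List.not_mem_nil, or_false, not_or,
    Walk.IsPath.nil, Sym2.eq_iff]
  grind

theorem _root_.SimpleGraph.IsAcyclic.no_six (h : R.IsAcyclic) {a b c d e f : V} (h1 : R.Adj a b)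
    (h2 : R.Adj b c) (h3 : R.Adj c d) (h4 : R.Adj d e) (h5 : R.Adj e f) (h6 : R.Adj f a)
    (hn : [a, b, c, d, e, f].Nodup) : False := by
  refine h (.cons h1 (.cons h2 (.cons h3 (.cons h4 (.cons h5 (.cons h6 .nil)))))) ?_
  simp only [List.nodup_cons, List.mem_cons, List.not_mem_nil, or_false, not_or] at hn
  simp only [Walk.cons_isCycle_iff, Walk.cons_isPath_iff, Walk.edges_cons, Walk.edges_nil,
    Walk.support_cons, Walk.support_nil, List.mem_cons, List.not_mem_nil, or_false, not_or,
    Walk.IsPath.nil, Sym2.eq_iff]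
  grind
end Cycles


/-! ### Subgraphs that no matching can decycle. -/

section Forbidden
variable {V : Type*} {G : SimpleGraph V} {p : V → V}

theorem unmatched_three (h : (unmatched G p).IsAcyclic) {a b c : V} (h1 : G.Adj a b)
    (h2 : G.Adj b c) (h3 : G.Adj c a) :
    (p a = b ∧ p b = a) ∨ (p b = c ∧ p c = b) ∨ (p c = a ∧ p a = c) := by
  by_contra! hn
  exact h.no_three (a := a) (b := b) (c := c) ⟨h1, fun h => hn.1 h.1 h.2⟩
    ⟨h2, fun h => hn.2.1 h.1 h.2⟩ ⟨h3, fun h => hn.2.2 h.1 h.2⟩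

theorem unmatched_four (h : (unmatched G p).IsAcyclic) {a b c d : V} (h1 : G.Adj a b)
    (h2 : G.Adj b c) (h3 : G.Adj c d) (h4 : G.Adj d a) (hac : a ≠ c) (hbd : b ≠ d) :
    (p a = b ∧ p b = a) ∨ (p b = c ∧ p c = b) ∨ (p c = d ∧ p d = c) ∨ (p d = a ∧ p a = d) := by
  by_contra! hn
  exact h.no_four (a := a) (b := b) (c := c) (d := d) ⟨h1, fun h => hn.1 h.1 h.2⟩
    ⟨h2, fun h => hn.2.1 h.1 h.2⟩ ⟨h3, fun h => hn.2.2.1 h.1 h.2⟩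
    ⟨h4, fun h => hn.2.2.2 h.1 h.2⟩ hac hbd

/-- At least four edges on four vertices remain. The cases are the three four-cycles and four
triangles of `K_4`. -/
theorem IsMDecyclable.no_complete_four (hG : IsMDecyclable G) {a b c d : V} (hab : G.Adj a b)
    (hac : G.Adj a c) (had : G.Adj a d) (hbc : G.Adj b c) (hbd : G.Adj b d) (hcd : G.Adj c d) :
    False := by
  obtain ⟨p, hp⟩ := isMDecyclable_iff.1 hG
  have := hab.ne; have := hac.ne; have := had.ne; have := hbc.ne; have := hbd.ne; have := hcd.ne
  have t1 := unmatched_four hp hab hbc hcd had.symm ‹_› ‹_›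
  have t2 := unmatched_four hp hab hbd hcd.symm hac.symm ‹_› ‹_›
  have t3 := unmatched_four hp hac hbc.symm hbd had.symm ‹_› ‹_›
  have t4 := unmatched_three hp hab hbc hac.symm
  have t5 := unmatched_three hp hab hbd had.symm
  have t6 := unmatched_three hp hac hcd had.symm
  have t7 := unmatched_three hp hbc hcd hbd.symm
  grind

/-- If `xy` is matched, the cycle `x a y b` survives. Otherwise each of three triangles on `xy`
loses its own edge at `x` or `y`, but these two vertices carry at most two matched edges. -/
theorem IsMDecyclable.no_book (hG : IsMDecyclable G) {x y a b c : V} (hxy : G.Adj x y)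
    (hxa : G.Adj x a) (hxb : G.Adj x b) (hxc : G.Adj x c) (hya : G.Adj y a) (hyb : G.Adj y b)
    (hyc : G.Adj y c) (hab : a ≠ b) (hac : a ≠ c) (hbc : b ≠ c) : False := by
  obtain ⟨p, hp⟩ := isMDecyclable_iff.1 hG
  have := hxy.ne; have := hxa.ne; have := hxb.ne; have := hxc.ne
  have := hya.ne; have := hyb.ne; have := hyc.ne
  have t1 := unmatched_three hp hxy hya hxa.symm
  have t2 := unmatched_three hp hxy hyb hxb.symm
  have t3 := unmatched_three hp hxy hyc hxc.symm
  have t4 := unmatched_four hp hxa hya.symm hyb hxb.symm ‹_› ‹_›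
  grind

/-- At least two of the four vertices are matched to neither `x` nor `y`, and with `x`, `y` they
form a surviving four-cycle. -/
theorem IsMDecyclable.no_two_four (hG : IsMDecyclable G) {x y a b c d : V} (hxy : x ≠ y)
    (hx : ∀ v ∈ [a, b, c, d], G.Adj x v) (hy : ∀ v ∈ [a, b, c, d], G.Adj y v)
    (hn : [a, b, c, d].Nodup) : False := by
  obtain ⟨p, hp⟩ := isMDecyclable_iff.1 hG
  have key : ∀ u ∈ [a, b, c, d], ∀ v ∈ [a, b, c, d], u ≠ v →
      p x = u ∨ p x = v ∨ p y = u ∨ p y = v := by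
    intro u hu v hv huv
    have := unmatched_four hp (hx u hu) (hy u hu).symm (hy v hv) (hx v hv).symm hxy huv
    tauto
  simp only [List.nodup_cons, List.mem_cons, List.not_mem_nil, or_false, not_or] at hn
  have k1 := key a (by simp) b (by simp) (by grind)
  have k2 := key a (by simp) c (by simp) (by grind)
  have k3 := key a (by simp) d (by simp) (by grind)
  have k4 := key b (by simp) c (by simp) (by grind)
  have k5 := key b (by simp) d (by simp) (by grind)
  have k6 := key c (by simp) d (by simp) (by grind)
  grind

/-- The four-cycles force a perfect matching, whose removal leaves a six-cycle. -/
theorem IsMDecyclable.no_three_three (hG : IsMDecyclable G) {a b c d e f : V}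
    (ha : ∀ v ∈ [d, e, f], G.Adj a v) (hb : ∀ v ∈ [d, e, f], G.Adj b v)
    (hc : ∀ v ∈ [d, e, f], G.Adj c v) (hn : [a, b, c, d, e, f].Nodup) : False := by
  obtain ⟨p, hp⟩ := isMDecyclable_iff.1 hG
  have key : ∀ u ∈ [a, b, c], ∀ v ∈ [a, b, c], u ≠ v → ∀ s ∈ [d, e, f], ∀ t ∈ [d, e, f], s ≠ t →
      (p u = s ∧ p s = u) ∨ (p s = v ∧ p v = s) ∨ (p v = t ∧ p t = v) ∨ (p t = u ∧ p u = t) := by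
    intro u hu v hv huv s hs t ht hst
    have h : ∀ u ∈ [a, b, c], ∀ s ∈ [d, e, f], G.Adj u s := by grind
    exact unmatched_four hp (h u hu s hs) (h v hv s hs).symm (h v hv t ht) (h u hu t ht).symm
      huv hst
  have key6 : ∀ u ∈ [d, e, f], ∀ v ∈ [d, e, f], ∀ w ∈ [d, e, f], u ≠ v → u ≠ w → v ≠ w →
      p a = u → p b = v → p c = w → False := by
    intro u hu v hv w hw huv huw hvw h1 h2 h3
    refine hp.no_six (a := a) (b := v) (c := c) (d := u) (e := b) (f := w)
      ⟨ha v hv, ?_⟩ ⟨(hc v hv).symm, ?_⟩ ⟨hc u hu, ?_⟩ ⟨(hb u hu).symm, ?_⟩ ⟨hb w hw, ?_⟩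
      ⟨(ha w hw).symm, ?_⟩ ?_
    all_goals
      clear key ha hb hc
      simp only [List.nodup_cons, List.mem_cons, List.not_mem_nil, or_false, not_or] at *
      grind
  simp only [List.nodup_cons, List.mem_cons, List.not_mem_nil, or_false, not_or] at hn
  obtain ⟨⟨hab, hac, -⟩, ⟨hbc, -⟩, -, ⟨hde, hdf⟩, hef, -⟩ := hn
  -- If `p u` misses the other side or equals `p v`, two vertices `s`, `t` avoiding `p v` give an
  -- intact four-cycle `u s v t`.
  have two : ∀ w, ∃ s ∈ [d, e, f], ∃ t ∈ [d, e, f], s ≠ t ∧ w ≠ s ∧ w ≠ t := by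
    intro w
    by_cases h1 : w = d
    · exact ⟨e, by simp, f, by simp, hef, by rwa [h1], by rwa [h1]⟩
    · by_cases h2 : w = e
      · exact ⟨d, by simp, f, by simp, hdf, h1, by rwa [h2]⟩
      · exact ⟨d, by simp, e, by simp, hde, h1, h2⟩
  have hfin : ∀ u ∈ [a, b, c], p u ∈ [d, e, f] := by
    intro u hu
    by_contra hpu
    obtain ⟨v, hv, huv⟩ : ∃ v ∈ [a, b, c], u ≠ v := by
      by_cases h : u = a
      · exact ⟨b, by simp, by rwa [h]⟩
      · exact ⟨a, by simp, h⟩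
    obtain ⟨s, hs, t, ht, hst, h1, h2⟩ := two (p v)
    rcases key u hu v hv huv s hs t ht hst with h | h | h | h
    · exact hpu (h.1 ▸ hs)
    · exact h1 h.2
    · exact h2 h.1
    · exact hpu (h.2 ▸ ht)
  have hinj : ∀ u ∈ [a, b, c], ∀ v ∈ [a, b, c], u ≠ v → p u ≠ p v := by
    intro u hu v hv huv hpu
    obtain ⟨s, hs, t, ht, hst, h1, h2⟩ := two (p v)
    rcases key u hu v hv huv s hs t ht hst with h | h | h | h
    · exact h1 (hpu ▸ h.1)
    · exact h1 h.2
    · exact h2 h.1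
    · exact h2 (hpu ▸ h.2)
  exact key6 (p a) (hfin a (by simp)) (p b) (hfin b (by simp)) (p c) (hfin c (by simp))
    (hinj a (by simp) b (by simp) hab) (hinj a (by simp) c (by simp) hac)
    (hinj b (by simp) c (by simp) hbc) rfl rfl rfl

theorem IsMDecyclable.no_two_three_add (hG : IsMDecyclable G) {x y a b c : V}
    (hxa : G.Adj x a) (hxb : G.Adj x b) (hxc : G.Adj x c) (hya : G.Adj y a) (hyb : G.Adj y b)
    (hyc : G.Adj y c) (hxy : x ≠ y) (hab : G.Adj a b) (hac : a ≠ c) (hbc : b ≠ c) : False := by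
  obtain ⟨p, hp⟩ := isMDecyclable_iff.1 hG
  have := hab.ne; have := hxa.ne; have := hxb.ne; have := hxc.ne
  have := hya.ne; have := hyb.ne; have := hyc.ne
  have t1 := unmatched_three hp hxa hab hxb.symm
  have t2 := unmatched_three hp hya hab hyb.symm
  have t3 := unmatched_four hp hxa hya.symm hyb hxb.symm ‹_› ‹_›
  have t4 := unmatched_four hp hxa hya.symm hyc hxc.symm ‹_› ‹_›
  have t5 := unmatched_four hp hxb hyb.symm hyc hxc.symm ‹_› ‹_›
  -- If `ab` were matched, `x a y b` would survive. So the triangles force `x` and `y` to be matched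
  -- to `a` and `b` in some order, and a five-cycle through `c` remains.
  have five : ∀ u v, (u = a ∧ v = b) ∨ (u = b ∧ v = a) → p x = u → p y = v → False := by
    intro u v huv h1 h2
    refine hp.no_five (a := x) (b := v) (c := u) (d := y) (e := c) ⟨?_, ?_⟩ ⟨?_, ?_⟩ ⟨?_, ?_⟩
      ⟨hyc, ?_⟩ ⟨hxc.symm, ?_⟩ ?_ <;> grind [SimpleGraph.Adj.symm]
  have f1 := five a b
  have f2 := five b a
  grind

end Forbidden

/-! ### Hubs: a universal vertex and the components left without it. -/

/-- `x` is adjacent to all other vertices, every vertex has at most two neighbours other than `x`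
in `G - x`, and at most one vertex of `G - x` has two. -/
structure IsHub {V : Type*} (G : SimpleGraph V) (x : V) : Prop where
  adj : ∀ v, v ≠ x → G.Adj x v
  degree_le : ∀ b a c d, b ≠ x → a ≠ x → c ≠ x → d ≠ x → G.Adj b a → G.Adj b c → G.Adj b d →
    a = c ∨ a = d ∨ c = d
  center_unique : ∀ b a c b' a' c', b ≠ x → a ≠ x → c ≠ x → b' ≠ x → a' ≠ x → c' ≠ x →
    G.Adj b a → G.Adj b c → a ≠ c → G.Adj b' a' → G.Adj b' c' → a' ≠ c' → b = b'

section Hub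
variable {V : Type*} {G : SimpleGraph V} {x : V}

/-- Match the ends of each `K_2` component of `G - x`; on the path `a - b - c`, if present, match
`b` with `c` and `x` with `a`. What remains is a tree rooted at `x`, in which `a` hangs below `b`.
-/
theorem IsHub.isMDecyclable (h : IsHub G x) : IsMDecyclable G := by
  classical
  let f : V → V := fun v => if hv : ∃ w, w ≠ x ∧ G.Adj v w then hv.choose else v
  have hf : ∀ u v, v ≠ x → G.Adj u v → f u ≠ x ∧ G.Adj u (f u) := by
    intro u v hv huv
    have hu : ∃ w, w ≠ x ∧ G.Adj u w := ⟨v, hv, huv⟩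
    simp only [f, dif_pos hu]
    exact hu.choose_spec
  clear_value f
  by_cases hc : ∃ b a c, b ≠ x ∧ a ≠ x ∧ c ≠ x ∧ G.Adj b a ∧ G.Adj b c ∧ a ≠ c
  · obtain ⟨b, a, c, hb, ha, hc, hba, hbc, hac⟩ := hc
    have huniq : ∀ u v w, u ≠ b → u ≠ x → v ≠ x → w ≠ x → G.Adj u v → G.Adj u w → v = w := by
      intro u v w hub hu hv hw huv huw
      by_contra hvw
      exact hub (h.center_unique u v w b a c hu hv hw hb ha hc huv huw hvw hba hbc hac)
    have hbn : ∀ v, v ≠ x → G.Adj b v → v = a ∨ v = c := by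
      intro v hv hbv
      have := h.degree_le b a c v hb ha hc hv hba hbc hbv
      grind
    have := hba.ne; have := hbc.ne
    refine isMDecyclable_of_parent
      (fun v => if v = x then a else if v = a then x else if v = b then c else if v = c then b
        else f v)
      (fun v => if v = a then b else x)
      (fun v => if v = x then 0 else if v = a then 2 else 1) ?_
    have key : ∀ u v, u ≠ x → v ≠ x → G.Adj u v → (u = b ∧ v = a) ∨ (u = a ∧ v = b) ∨
        (u = b ∧ v = c) ∨ (u = c ∧ v = b) ∨
        (u ≠ a ∧ u ≠ b ∧ u ≠ c ∧ v ≠ a ∧ v ≠ b ∧ v ≠ c ∧ f u = v ∧ f v = u) := by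
      intro u v hu hv huv
      have aux : ∀ u v, u ≠ x → v ≠ x → G.Adj u v → (u = b ∧ v = a) ∨ (u = a ∧ v = b) ∨
          (u = b ∧ v = c) ∨ (u = c ∧ v = b) ∨ (u ≠ a ∧ u ≠ b ∧ u ≠ c) := by
        intro u v hu hv huv
        by_cases h1 : u = b
        · have := hbn v hv (h1 ▸ huv)
          tauto
        by_cases h2 : u = a
        · have := huniq a v b (by grind) ha hv hb (h2 ▸ huv) hba.symm
          tauto
        by_cases h3 : u = c
        · have := huniq c v b (by grind) hc hv hb (h3 ▸ huv) hbc.symm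
          tauto
        tauto
      have h1 := aux u v hu hv huv
      have h2 := aux v u hv hu huv.symm
      rcases h1 with h1 | h1 | h1 | h1 | ⟨u1, u2, u3⟩
      · exact Or.inl h1
      · exact Or.inr (Or.inl h1)
      · exact Or.inr (Or.inr (Or.inl h1))
      · exact Or.inr (Or.inr (Or.inr (Or.inl h1)))
      rcases h2 with h2 | h2 | h2 | h2 | ⟨v1, v2, v3⟩
      · exact absurd h2.2 u1
      · exact absurd h2.2 u2
      · exact absurd h2.2 u3
      · exact absurd h2.2 u2
      have h3 := hf u v hv huv
      have h4 := hf v u hu huv.symm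
      exact Or.inr (Or.inr (Or.inr (Or.inr ⟨u1, u2, u3, v1, v2, v3,
        huniq u _ _ u2 hu h3.1 hv h3.2 huv, huniq v _ _ v2 hv h4.1 hu h4.2 huv.symm⟩)))
    intro u v huv
    have huv' := huv.ne
    replace key := key u v
    clear huniq hbn hf
    by_cases hu : u = x
    · by_cases hva : v = a <;> grind
    by_cases hv : v = x
    · by_cases hua : u = a <;> grind
    rcases key hu hv huv with h | h | h | h | h <;> grind
  · refine isMDecyclable_of_parent f (fun _ => x) (fun v => if v = x then 0 else 1) ?_
    have huniq : ∀ u v w, u ≠ x → v ≠ x → w ≠ x → G.Adj u v → G.Adj u w → v = w := by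
      intro u v w hu hv hw huv huw
      by_contra hvw
      exact hc ⟨u, v, w, hu, hv, hw, huv, huw, hvw⟩
    intro u v huv
    have huv' := huv.ne
    by_cases hu : u = x
    · grind
    by_cases hv : v = x
    · grind
    have h3 := hf u v hv huv
    have h4 := hf v u hu huv.symm
    exact Or.inl ⟨huniq u _ _ hu h3.1 hv h3.2 huv, huniq v _ _ hv h4.1 hu h4.2 huv.symm⟩

theorem IsMDecyclable.isHub (hG : IsMDecyclable G) (hx : ∀ v, v ≠ x → G.Adj x v) :
    IsHub G x := by
  refine ⟨hx, ?_, ?_⟩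
  · intro b a c d hb ha hc hd hba hbc hbd
    by_contra! hn
    exact hG.no_book (hx b hb) (hx a ha) (hx c hc) (hx d hd) hba hbc hbd hn.1 hn.2.1 hn.2.2
  · intro b a c b' a' c' hb ha hc hb' ha' hc' hba hbc hac hba' hbc' hac'
    obtain ⟨p, hp⟩ := isMDecyclable_iff.1 hG
    -- The triangles `x b a`, `x b c` and the cycle `x a b c` force `x` to be matched to one of `a`,
    -- `c` and `b` to the other.
    have key : ∀ b a c, b ≠ x → a ≠ x → c ≠ x → G.Adj b a → G.Adj b c → a ≠ c →
        (p x = a ∧ p b = c) ∨ (p x = c ∧ p b = a) := by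
      intro b a c hb ha hc hba hbc hac
      have t1 := unmatched_three hp (hx b hb) hba (hx a ha).symm
      have t2 := unmatched_three hp (hx b hb) hbc (hx c hc).symm
      have t3 := unmatched_four hp (hx a ha) hba.symm hbc (hx c hc).symm hb.symm hac
      have := hba.ne; have := hbc.ne
      grind
    -- The partner of `x` is then a common neighbour of both centres, and if they differ the
    -- four-cycle on `x`, this vertex and the centres survives.
    have key2 : ∀ a, a ≠ x → p x = a → G.Adj b a → G.Adj b' a → p b ≠ x → p b' ≠ x →
        p b ≠ a → p b' ≠ a → b = b' := by
      intro a ha hpx h1 h2 h3 h4 h5 h6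
      by_contra hbb
      have := unmatched_four hp (hx b hb) h1 h2.symm (hx b' hb').symm ha.symm hbb
      grind
    have k1 := key b a c hb ha hc hba hbc hac
    have k2 := key b' a' c' hb' ha' hc' hba' hbc' hac'
    have k3 := key2 a ha
    have k4 := key2 c hc
    grind

theorem eq_of_preconnected_induce {S T : Set V} (hS : (G.induce S).Preconnected) (hTS : T ⊆ S)
    (hT : T.Nonempty) (h : ∀ u ∈ T, ∀ v ∈ S, G.Adj u v → v ∈ T) : S = T := by
  refine Set.Subset.antisymm (fun w hw => ?_) hTS
  by_contra hwT
  obtain ⟨t, ht⟩ := hT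
  obtain ⟨a, b, -, hab, ha, hb⟩ := exists_adj_boundary (P := fun v : S => (v : V) ∈ T)
    (hS ⟨t, hTS ht⟩ ⟨w, hw⟩) ht hwT
  exact hb (h a ha b b.2 hab)

/-- Away from `x` degrees are at most two and only one vertex has degree two, so a vertex of largest
degree inside `S` together with its neighbours there exhausts `S`. Applied to `G - x` and to blocks
without `x`. -/
theorem IsHub.eq_of_preconnected (h : IsHub G x) {S : Set V} (hx : x ∉ S) (hne : S.Nonempty)
    (hS : (G.induce S).Preconnected) :
    (∃ a, S = {a}) ∨ (∃ a b, G.Adj a b ∧ S = {a, b}) ∨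
      ∃ a b c, G.Adj b a ∧ G.Adj b c ∧ a ≠ c ∧ ¬ G.Adj a c ∧ S = {a, b, c} := by
  have hSx : ∀ v ∈ S, v ≠ x := fun v hv hvx => hx (hvx ▸ hv)
  by_cases hc : ∃ b ∈ S, ∃ a ∈ S, ∃ c ∈ S, G.Adj b a ∧ G.Adj b c ∧ a ≠ c
  · obtain ⟨b, hb, a, ha, c, hc, hba, hbc, hac⟩ := hc
    have huniq : ∀ u ∈ S, ∀ v ∈ S, ∀ w ∈ S, u ≠ b → G.Adj u v → G.Adj u w → v = w := by
      intro u hu v hv w hw hub huv huw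
      by_contra hvw
      exact hub (h.center_unique u v w b a c (hSx u hu) (hSx v hv) (hSx w hw) (hSx b hb)
        (hSx a ha) (hSx c hc) huv huw hvw hba hbc hac)
    refine Or.inr (Or.inr ⟨a, b, c, hba, hbc, hac, ?_, ?_⟩)
    · intro hac'
      exact hbc.ne (huniq a ha b hb c hc hba.ne.symm hba.symm hac')
    · refine eq_of_preconnected_induce hS ?_ ⟨a, by simp⟩ ?_
      · rintro v (rfl | rfl | rfl) <;> assumption
      · rintro u (rfl | rfl | rfl) v hv huv
        · simp [huniq u ha v hv b hb hba.ne.symm huv hba.symm]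
        · have := h.degree_le u a c v (hSx _ hb) (hSx _ ha) (hSx _ hc) (hSx _ hv) hba hbc huv
          simp only [Set.mem_insert_iff, Set.mem_singleton_iff]
          grind
        · simp [huniq u hc v hv b hb hbc.ne.symm huv hbc.symm]
  · obtain ⟨b, hb⟩ := hne
    have huniq : ∀ u ∈ S, ∀ v ∈ S, ∀ w ∈ S, G.Adj u v → G.Adj u w → v = w := by
      intro u hu v hv w hw huv huw
      by_contra hvw
      exact hc ⟨u, hu, v, hv, w, hw, huv, huw, hvw⟩
    by_cases ha : ∃ a ∈ S, G.Adj b a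
    · obtain ⟨a, ha, hba⟩ := ha
      refine Or.inr (Or.inl ⟨b, a, hba, ?_⟩)
      refine eq_of_preconnected_induce hS ?_ ⟨a, by simp⟩ ?_
      · rintro v (rfl | rfl) <;> assumption
      · rintro u (rfl | rfl) v hv huv
        · simp [huniq u hb v hv a ha huv hba]
        · simp [huniq u ha v hv b hb huv hba.symm]
    · refine Or.inl ⟨b, eq_of_preconnected_induce hS ?_ ⟨b, rfl⟩ ?_⟩
      · rintro v rfl
        exact hb
      · rintro u rfl v hv huv
        exact absurd ⟨v, hv, huv⟩ ha

end Hub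

/-! ### Recognising the small graphs. -/

section Iso
variable {V : Type*} {G : SimpleGraph V}

theorem nonempty_iso_of_bijective {W : Type*} {K : SimpleGraph W} (f : W → V)
    (hf : Function.Bijective f) (h : ∀ i j, G.Adj (f i) (f j) ↔ K.Adj i j) :
    Nonempty (G ≃g K) :=
  ⟨(RelIso.mk (Equiv.ofBijective f hf) (h _ _) : K ≃g G).symm⟩

theorem nonempty_iso_two {a b : V} (hab : G.Adj a b) (h : ∀ v, v = a ∨ v = b) :
    Nonempty (G ≃g completeGraph (Fin 2)) := by
  have := hab.ne
  refine nonempty_iso_of_bijective ![a, b] ⟨?_, ?_⟩ ?_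
  · intro i j; fin_cases i <;> fin_cases j <;> simp <;> grind
  · intro v
    rcases h v with rfl | rfl
    exacts [⟨0, rfl⟩, ⟨1, rfl⟩]
  · intro i j; fin_cases i <;> fin_cases j <;> simp_all [G.adj_comm]

theorem nonempty_iso_three {a b c : V} (hab : G.Adj a b) (hac : G.Adj a c) (hbc : G.Adj b c)
    (h : ∀ v, v = a ∨ v = b ∨ v = c) : Nonempty (G ≃g completeGraph (Fin 3)) := by
  have := hab.ne; have := hac.ne; have := hbc.ne
  have := hab.symm; have := hac.symm; have := hbc.symm
  refine nonempty_iso_of_bijective ![a, b, c] ⟨?_, ?_⟩ ?_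
  · intro i j; fin_cases i <;> fin_cases j <;> simp <;> grind
  · intro v
    rcases h v with rfl | rfl | rfl
    exacts [⟨0, rfl⟩, ⟨1, rfl⟩, ⟨2, rfl⟩]
  · intro i j; fin_cases i <;> fin_cases j <;> simp_all

theorem nonempty_iso_diamond {a b c d : V} (hab : G.Adj a b) (hac : G.Adj a c) (had : G.Adj a d)
    (hbc : G.Adj b c) (hcd : G.Adj c d) (hbd : b ≠ d) (hbd' : ¬ G.Adj b d)
    (h : ∀ v, v = a ∨ v = b ∨ v = c ∨ v = d) : Nonempty (G ≃g diamond) := by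
  have := hab.ne; have := hac.ne; have := had.ne; have := hbc.ne; have := hcd.ne
  have := hab.symm; have := hac.symm; have := had.symm; have := hbc.symm; have := hcd.symm
  have : ¬ G.Adj d b := fun h => hbd' h.symm
  refine nonempty_iso_of_bijective ![a, b, c, d] ⟨?_, ?_⟩ ?_
  · intro i j; fin_cases i <;> fin_cases j <;> simp <;> grind
  · intro v
    rcases h v with rfl | rfl | rfl | rfl
    exacts [⟨0, rfl⟩, ⟨1, rfl⟩, ⟨2, rfl⟩, ⟨3, rfl⟩]
  · intro i j
    rw [diamond_adj]
    fin_cases i <;> fin_cases j <;> simp_all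

theorem nonempty_iso_cycle_four {a b c d : V} (hab : G.Adj a b) (hbc : G.Adj b c)
    (hcd : G.Adj c d) (hda : G.Adj d a) (hac : a ≠ c) (hac' : ¬ G.Adj a c) (hbd : b ≠ d)
    (hbd' : ¬ G.Adj b d) (h : ∀ v, v = a ∨ v = b ∨ v = c ∨ v = d) :
    Nonempty (G ≃g cycleGraph 4) := by
  have := hab.ne; have := hbc.ne; have := hcd.ne; have := hda.ne
  have := hab.symm; have := hbc.symm; have := hcd.symm; have := hda.symm
  have : ¬ G.Adj d b := fun h => hbd' h.symm
  have : ¬ G.Adj c a := fun h => hac' h.symm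
  refine nonempty_iso_of_bijective ![a, b, c, d] ⟨?_, ?_⟩ ?_
  · intro i j; fin_cases i <;> fin_cases j <;> simp <;> grind
  · intro v
    rcases h v with rfl | rfl | rfl | rfl
    exacts [⟨0, rfl⟩, ⟨1, rfl⟩, ⟨2, rfl⟩, ⟨3, rfl⟩]
  · have hadj : ∀ i j : Fin 4, (cycleGraph 4).Adj i j ↔
        i ≠ j ∧ ¬ (i = 0 ∧ j = 2) ∧ ¬ (i = 2 ∧ j = 0) ∧ ¬ (i = 1 ∧ j = 3) ∧
          ¬ (i = 3 ∧ j = 1) := by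
      simp only [cycleGraph_adj]
      decide
    intro i j
    rw [hadj]
    fin_cases i <;> fin_cases j <;> simp_all

theorem nonempty_iso_completeBipartite {a b c d e : V} (h1 : ∀ v ∈ [c, d, e], G.Adj a v)
    (h2 : ∀ v ∈ [c, d, e], G.Adj b v) (hab : a ≠ b) (hab' : ¬ G.Adj a b) (hcd : c ≠ d)
    (hcd' : ¬ G.Adj c d) (hce : c ≠ e) (hce' : ¬ G.Adj c e) (hde : d ≠ e) (hde' : ¬ G.Adj d e)
    (h : ∀ v, v = a ∨ v = b ∨ v = c ∨ v = d ∨ v = e) :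
    Nonempty (G ≃g completeBipartiteGraph (Fin 2) (Fin 3)) := by
  simp only [List.mem_cons, List.not_mem_nil, or_false, forall_eq_or_imp, forall_eq] at h1 h2
  obtain ⟨hac, had, hae⟩ := h1
  obtain ⟨hbc, hbd, hbe⟩ := h2
  have := hac.ne; have := had.ne; have := hae.ne; have := hbc.ne; have := hbd.ne
  have := hbe.ne
  have := hac.symm; have := had.symm; have := hae.symm; have := hbc.symm; have := hbd.symm
  have := hbe.symm
  have : ¬ G.Adj b a := fun h => hab' h.symm
  have : ¬ G.Adj d c := fun h => hcd' h.symm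
  have : ¬ G.Adj e c := fun h => hce' h.symm
  have : ¬ G.Adj e d := fun h => hde' h.symm
  refine nonempty_iso_of_bijective (Sum.elim ![a, b] ![c, d, e]) ⟨?_, ?_⟩ ?_
  · rintro (i | i) (j | j) <;> fin_cases i <;> fin_cases j <;> simp <;> grind
  · intro v
    rcases h v with rfl | rfl | rfl | rfl | rfl
    exacts [⟨.inl 0, rfl⟩, ⟨.inl 1, rfl⟩, ⟨.inr 0, rfl⟩, ⟨.inr 1, rfl⟩, ⟨.inr 2, rfl⟩]
  · rintro (i | i) (j | j) <;> fin_cases i <;> fin_cases j <;> simp_all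

end Iso

/-! ### Blocks of a graph with a universal vertex. -/

section Blocks
variable {V : Type*} {G : SimpleGraph V} {x : V}

/-- Bridges, triangles and diamonds are told apart by their 2, 3 and 4 vertices. -/
theorem encard_verts_of_iso {B : G.Subgraph} {n : ℕ} {K : SimpleGraph (Fin n)}
    (h : Nonempty (B.coe ≃g K)) : B.verts.encard = n := by
  obtain ⟨e⟩ := h
  rw [← ENat.card_coe_set_eq, ENat.card_congr e.toEquiv]
  simp

theorem IsBridgeSubgraph.encard_verts {B : G.Subgraph} (h : IsBridgeSubgraph B) :
    B.verts.encard = 2 := by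
  obtain ⟨u, v, huv, -, rfl⟩ := h
  exact Set.encard_pair huv.ne

theorem IsTwoConnected.three_le_encard {B : G.Subgraph} (h : IsTwoConnected B.coe) :
    3 ≤ B.verts.encard := by
  rw [← ENat.card_coe_set_eq]
  exact h.1

theorem encard_insert_triple {a b c : V} (ha : a ≠ x) (hb : b ≠ x) (hc : c ≠ x) (hab : a ≠ b)
    (hac : a ≠ c) (hbc : b ≠ c) : ({x, a, b, c} : Set V).encard = 4 := by
  rw [Set.encard_insert_of_notMem, Set.encard_insert_of_notMem, Set.encard_pair hbc]
  · norm_num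
  · simp [hab, hac]
  · simp [ha.symm, hb.symm, hc.symm]

theorem preconnected_induce_of_center {S : Set V} {b : V} (hb : b ∈ S)
    (h : ∀ v ∈ S, v ≠ b → G.Adj b v) : (G.induce S).Preconnected := by
  have key : ∀ v : S, (G.induce S).Reachable ⟨b, hb⟩ v := by
    intro v
    by_cases hv : (v : V) = b
    · have : v = ⟨b, hb⟩ := Subtype.ext hv
      rw [this]
    · exact Adj.reachable (h v v.2 hv)
  exact fun u v => (key u).symm.trans (key v)

/-- The subgraph of `G` induced on `S` together with `x`. -/
def fan (G : SimpleGraph V) (x : V) (S : Set V) : G.Subgraph :=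
  (⊤ : G.Subgraph).induce (insert x S)

theorem le_fan {B : G.Subgraph} {S : Set V} (h : B.verts ⊆ insert x S) : B ≤ fan G x S := by
  refine ⟨h, fun u v huv => ?_⟩
  exact ⟨h huv.fst_mem, h huv.snd_mem, huv.adj_sub⟩

theorem fan_adj {S : Set V} {u v : V} :
    (fan G x S).Adj u v ↔ u ∈ insert x S ∧ v ∈ insert x S ∧ G.Adj u v := Iff.rfl

/-- Deleting `x` leaves the connected `S`; after deleting any other vertex, `x` still sees
everything. -/
theorem isTwoConnected_fan (hx : ∀ v, v ≠ x → G.Adj x v) {S : Set V} (hxS : x ∉ S)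
    (hS : S.Nontrivial) (hconn : (G.induce S).Preconnected) : IsTwoConnected (fan G x S).coe := by
  have hmem : x ∈ (fan G x S).verts := Set.mem_insert x S
  have hadj : ∀ v : (fan G x S).verts, (v : V) ≠ x → (fan G x S).coe.Adj ⟨x, hmem⟩ v :=
    fun v hv => ⟨hmem, v.2, hx v hv⟩
  refine ⟨?_, ?_, ?_⟩
  · rw [ENat.card_coe_set_eq]
    change 3 ≤ (insert x S).encard
    rw [Set.encard_insert_of_notMem hxS]
    have := Set.one_lt_encard_iff_nontrivial.2 hS
    have h2 : (2 : ℕ∞) ≤ S.encard := by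
      rw [← one_add_one_eq_two]
      exact Order.add_one_le_of_lt this
    calc (3 : ℕ∞) = 2 + 1 := by norm_num
      _ ≤ S.encard + 1 := by gcongr
  · have key : ∀ v, (fan G x S).coe.Reachable ⟨x, hmem⟩ v := by
      intro v
      by_cases hv : (v : V) = x
      · have : v = ⟨x, hmem⟩ := Subtype.ext hv
        rw [this]
      · exact (hadj v hv).reachable
    exact (connected_iff _).2 ⟨fun u v => (key u).symm.trans (key v), ⟨⟨x, hmem⟩⟩⟩
  · rintro v ⟨u, w, hu, hw, -, huw⟩
    by_cases hv : (v : V) = x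
    · have hS' : ∀ u : (fan G x S).verts, u ≠ v → (u : V) ∈ S := by
        intro u hu
        exact u.2.resolve_left fun h => hu (Subtype.ext (h.trans hv.symm))
      let f : G.induce S →g (fan G x S).coe.induce {y | y ≠ v} :=
        { toFun := fun s => ⟨⟨s, Set.mem_insert_of_mem x s.2⟩, by
            intro h
            have h' : (s : V) = v := congrArg Subtype.val h
            exact hxS (hv ▸ h' ▸ s.2)⟩
          map_rel' := fun {s t} hst =>
            ⟨Set.mem_insert_of_mem x s.2, Set.mem_insert_of_mem x t.2, hst⟩ }
      exact huw ((hconn ⟨u, hS' u hu⟩ ⟨w, hS' w hw⟩).map f)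
    · have hxv : (⟨x, hmem⟩ : (fan G x S).verts) ≠ v := fun h => hv (congrArg Subtype.val h).symm
      have key : ∀ (u : (fan G x S).verts) (hu : u ≠ v),
          ((fan G x S).coe.induce {y | y ≠ v}).Reachable ⟨⟨x, hmem⟩, hxv⟩ ⟨u, hu⟩ := by
        intro u hu
        by_cases hux : (u : V) = x
        · have : u = ⟨x, hmem⟩ := Subtype.ext hux
          subst this
          exact Reachable.refl _
        · refine Adj.reachable ?_
          exact hadj u hux
      exact huw ((key u hu).symm.trans (key w hw))

/-- A 2-connected subgraph avoiding `x` could be enlarged by `x`. Since `x` does not cut `B`, the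
rest of `B` is connected, and maximality makes `B` the whole fan over it. -/
theorem eq_fan_of_maximal (hx : ∀ v, v ≠ x → G.Adj x v) {B : G.Subgraph}
    (hB : Maximal (fun H : G.Subgraph => IsTwoConnected H.coe) B) :
    ∃ S : Set V, x ∉ S ∧ S.Nontrivial ∧ (G.induce S).Preconnected ∧ B = fan G x S := by
  have hcard := hB.prop.three_le_encard
  have hxB : x ∈ B.verts := by
    by_contra hxB
    have hS : (G.induce B.verts).Preconnected := by
      intro u w
      let f : B.coe →g G.induce B.verts :=
        { toFun := fun s => s
          map_rel' := fun {s t} hst => B.adj_sub hst }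
      exact (hB.prop.2.1.preconnected u w).map f
    have hnt : B.verts.Nontrivial := by
      rw [← Set.one_lt_encard_iff_nontrivial]
      exact lt_of_lt_of_le (by norm_num) hcard
    have hle : fan G x B.verts ≤ B :=
      hB.le_of_ge (isTwoConnected_fan hx hxB hnt hS) (le_fan (Set.subset_insert _ _))
    exact hxB (hle.1 (Set.mem_insert _ _))
  have hins : insert x (B.verts \ {x}) = B.verts := by
    rw [Set.insert_sdiff_singleton, Set.insert_eq_of_mem hxB]
  have hxS : x ∉ B.verts \ {x} := fun h => h.2 rfl
  have hnt : (B.verts \ {x}).Nontrivial := by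
    rw [← Set.one_lt_encard_iff_nontrivial]
    rw [← hins, Set.encard_insert_of_notMem hxS] at hcard
    by_contra h
    have h3 : (3 : ℕ∞) ≤ 1 + 1 := hcard.trans (by gcongr; exact not_lt.1 h)
    exact absurd h3 (by norm_num)
  have hS : (G.induce (B.verts \ {x})).Preconnected := by
    rintro ⟨u, hu⟩ ⟨w, hw⟩
    by_contra h
    refine hB.prop.2.2 ⟨x, hxB⟩ ⟨⟨u, hu.1⟩, ⟨w, hw.1⟩, ?_, ?_, hB.prop.2.1.preconnected _ _, ?_⟩
    · exact fun h => hu.2 (congrArg Subtype.val h)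
    · exact fun h => hw.2 (congrArg Subtype.val h)
    · intro hr
      let f : B.coe.induce {y | y ≠ ⟨x, hxB⟩} →g G.induce (B.verts \ {x}) :=
        { toFun := fun s => ⟨s, s.1.2, fun h => s.2 (Subtype.ext h)⟩
          map_rel' := fun {s t} hst => B.adj_sub hst }
      exact h (hr.map f)
  refine ⟨B.verts \ {x}, hxS, hnt, hS, ?_⟩
  exact hB.eq_of_le (isTwoConnected_fan hx hxS hnt hS) (le_fan hins.ge)

theorem IsHub.eq_fan_of_maximal (h : IsHub G x) {B : G.Subgraph}
    (hB : Maximal (fun H : G.Subgraph => IsTwoConnected H.coe) B) :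
    (∃ a b, a ≠ x ∧ b ≠ x ∧ G.Adj a b ∧ B = fan G x {a, b}) ∨
      ∃ a b c, a ≠ x ∧ b ≠ x ∧ c ≠ x ∧ G.Adj b a ∧ G.Adj b c ∧ a ≠ c ∧ ¬ G.Adj a c ∧
        B = fan G x {a, b, c} := by
  obtain ⟨S, hxS, hnt, hS, rfl⟩ := MDecyclable.eq_fan_of_maximal h.adj hB
  have hSx : ∀ v ∈ S, v ≠ x := fun v hv hvx => hxS (hvx ▸ hv)
  rcases h.eq_of_preconnected hxS hnt.nonempty hS with
    ⟨a, rfl⟩ | ⟨a, b, hab, rfl⟩ | ⟨a, b, c, hba, hbc, hac, hac', rfl⟩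
  · exact absurd hnt Set.not_nontrivial_singleton
  · exact Or.inl ⟨a, b, hSx a (by simp), hSx b (by simp), hab, rfl⟩
  · exact Or.inr ⟨a, b, c, hSx a (by simp), hSx b (by simp), hSx c (by simp), hba, hbc, hac,
      hac', rfl⟩

theorem nonempty_fan_pair_iso {a b : V} (hxa : G.Adj x a) (hxb : G.Adj x b) (hab : G.Adj a b) :
    Nonempty ((fan G x {a, b}).coe ≃g completeGraph (Fin 3)) := by
  have hx : x ∈ insert x ({a, b} : Set V) := by simp
  have ha : a ∈ insert x ({a, b} : Set V) := by simp
  have hb : b ∈ insert x ({a, b} : Set V) := by simp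
  refine nonempty_iso_three (a := ⟨x, hx⟩) (b := ⟨a, ha⟩) (c := ⟨b, hb⟩) ⟨hx, ha, hxa⟩
    ⟨hx, hb, hxb⟩ ⟨ha, hb, hab⟩ ?_
  rintro ⟨v, hv⟩
  rcases hv with rfl | rfl | rfl <;> simp

theorem nonempty_fan_triple_iso {a b c : V} (hxa : G.Adj x a) (hxb : G.Adj x b) (hxc : G.Adj x c)
    (hba : G.Adj b a) (hbc : G.Adj b c) (hac : a ≠ c) (hac' : ¬ G.Adj a c) :
    Nonempty ((fan G x {a, b, c}).coe ≃g diamond) := by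
  have hx : x ∈ insert x ({a, b, c} : Set V) := by simp
  have ha : a ∈ insert x ({a, b, c} : Set V) := by simp
  have hb : b ∈ insert x ({a, b, c} : Set V) := by simp
  have hc : c ∈ insert x ({a, b, c} : Set V) := by simp
  refine nonempty_iso_diamond (a := ⟨x, hx⟩) (b := ⟨a, ha⟩) (c := ⟨b, hb⟩) (d := ⟨c, hc⟩)
    ⟨hx, ha, hxa⟩ ⟨hx, hb, hxb⟩ ⟨hx, hc, hxc⟩ ⟨ha, hb, hba.symm⟩ ⟨hb, hc, hbc⟩ ?_ ?_ ?_
  · exact fun h => hac (congrArg Subtype.val h)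
  · exact fun h => hac' h.2.2
  · rintro ⟨v, hv⟩
    rcases hv with rfl | rfl | rfl | rfl <;> simp

theorem IsDiamondBlock.maximal {B : G.Subgraph} (h : IsDiamondBlock B) :
    Maximal (fun H : G.Subgraph => IsTwoConnected H.coe) B := by
  refine h.1.resolve_left fun h' => ?_
  have h1 := h'.encard_verts
  rw [encard_verts_of_iso h.2] at h1
  exact absurd h1 (by decide)

theorem IsHub.eq_fan_of_isDiamondBlock (h : IsHub G x) {B : G.Subgraph} (hB : IsDiamondBlock B) :
    ∃ a b c, a ≠ x ∧ b ≠ x ∧ c ≠ x ∧ G.Adj b a ∧ G.Adj b c ∧ a ≠ c ∧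
      B = fan G x {a, b, c} := by
  rcases h.eq_fan_of_maximal hB.maximal with
    ⟨a, b, ha, hb, hab, rfl⟩ | ⟨a, b, c, ha, hb, hc, hba, hbc, hac, -, rfl⟩
  · have h1 := encard_verts_of_iso hB.2
    rw [encard_verts_of_iso (nonempty_fan_pair_iso (h.adj a ha) (h.adj b hb) hab)] at h1
    exact absurd h1 (by decide)
  · exact ⟨a, b, c, ha, hb, hc, hba, hbc, hac, rfl⟩

/-- A diamond block is `x` with the path around the unique centre, whose two neighbours are
determined; hence it is unique and `x` has degree 3 in it. -/
theorem IsHub.isMDStar (h : IsHub G x) (hcut : IsCutVertex G x) : IsMDStar G := by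
  refine ⟨x, ?_, ?_, ?_, ?_⟩
  · intro v
    refine ⟨?_, by rintro rfl; exact hcut⟩
    rintro ⟨u, w, hu, hw, -, huw⟩
    by_contra hv
    have key : ∀ (u : V) (hu : u ≠ v),
        (G.induce {y | y ≠ v}).Reachable ⟨x, fun h => hv h.symm⟩ ⟨u, hu⟩ := by
      intro u hu
      by_cases hux : u = x
      · subst hux
        exact Reachable.refl _
      · exact Adj.reachable (h.adj u hux)
    exact huw ((key u hu).symm.trans (key w hw))
  · intro D D' hD hD'
    obtain ⟨a, b, c, ha, hb, hc, hba, hbc, hac, rfl⟩ := h.eq_fan_of_isDiamondBlock hD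
    obtain ⟨a', b', c', ha', hb', hc', hba', hbc', hac', rfl⟩ := h.eq_fan_of_isDiamondBlock hD'
    obtain rfl := h.center_unique b a c b' a' c' hb ha hc hb' ha' hc' hba hbc hac hba' hbc' hac'
    have h1 := h.degree_le b a c a' hb ha hc ha' hba hbc hba'
    have h2 := h.degree_le b a c c' hb ha hc hc' hba hbc hbc'
    congr 1
    ext v
    simp only [Set.mem_insert_iff, Set.mem_singleton_iff]
    grind
  · intro B hB hBd
    refine hB.imp_right fun hm => ?_
    rcases h.eq_fan_of_maximal hm with
      ⟨a, b, ha, hb, hab, rfl⟩ | ⟨a, b, c, ha, hb, hc, hba, hbc, hac, hac', rfl⟩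
    · exact nonempty_fan_pair_iso (h.adj a ha) (h.adj b hb) hab
    · exact absurd ⟨hB, nonempty_fan_triple_iso (h.adj a ha) (h.adj b hb) (h.adj c hc) hba hbc
        hac hac'⟩ hBd
  · intro D hD
    obtain ⟨a, b, c, ha, hb, hc, hba, hbc, hac, rfl⟩ := h.eq_fan_of_isDiamondBlock hD
    have : (fan G x {a, b, c}).neighborSet x = {a, b, c} := by
      ext v
      rw [Subgraph.mem_neighborSet, fan_adj]
      constructor
      · rintro ⟨-, h1, h2⟩
        exact h1.resolve_left h2.ne.symm
      · intro hv
        refine ⟨Set.mem_insert _ _, Set.mem_insert_of_mem _ hv, h.adj v ?_⟩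
        rcases hv with rfl | rfl | rfl <;> assumption
    rw [this, Set.ncard_eq_three]
    exact ⟨a, b, c, hba.ne.symm, hac, hbc.ne, rfl⟩

theorem exists_maximal_twoConnected [Finite V] {B : G.Subgraph} (hB : IsTwoConnected B.coe) :
    ∃ B', B ≤ B' ∧ Maximal (fun H : G.Subgraph => IsTwoConnected H.coe) B' :=
  Finite.exists_le_maximal (p := fun H : G.Subgraph => IsTwoConnected H.coe) hB

/-- A centre with two neighbours spans with `x` a 2-connected fan on four vertices, which must fill
a diamond block; a third neighbour would give a block with five vertices. -/
theorem IsMDStar.exists_isHub [Finite V] (hconn : G.Connected) (hG : PathFree G)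
    (h : IsMDStar G) : ∃ x, IsHub G x := by
  obtain ⟨x, hcut, hdia, hblock, -⟩ := h
  have hx : ∀ v, v ≠ x → G.Adj x v := fun v hv => ((hcut x).2 rfl).adj hconn hG hv
  have hmax : ∀ B : G.Subgraph, Maximal (fun H : G.Subgraph => IsTwoConnected H.coe) B →
      IsDiamondBlock B ∨ B.verts.encard = 3 := by
    intro B hB
    by_contra! hn
    rcases hblock B (Or.inr hB) hn.1 with h' | h'
    · have h3 := hB.prop.three_le_encard
      rw [h'.encard_verts] at h3
      exact absurd h3 (by decide)
    · exact hn.2 (encard_verts_of_iso h')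
  have hle : ∀ B : G.Subgraph, Maximal (fun H : G.Subgraph => IsTwoConnected H.coe) B →
      B.verts.encard ≤ 4 := by
    intro B hB
    rcases hmax B hB with h' | h'
    · exact (encard_verts_of_iso h'.2).le
    · rw [h']; decide
  have htriple : ∀ b a c, b ≠ x → a ≠ x → c ≠ x → G.Adj b a → G.Adj b c → a ≠ c →
      ∃ B : G.Subgraph, IsDiamondBlock B ∧ fan G x {a, b, c} ≤ B ∧ B.verts = {x, a, b, c} := by
    intro b a c hb ha hc hba hbc hac
    have hconn : (G.induce ({a, b, c} : Set V)).Preconnected := by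
      refine preconnected_induce_of_center (b := b) (by simp) ?_
      rintro v (rfl | rfl | rfl) hv <;> first | assumption | exact absurd rfl hv
    obtain ⟨B, hFB, hB⟩ := exists_maximal_twoConnected (isTwoConnected_fan hx
      (by simp [hb.symm, ha.symm, hc.symm]) ⟨a, by simp, b, by simp, hba.ne.symm⟩ hconn)
    have hsub : ({x, a, b, c} : Set V) ⊆ B.verts := hFB.1
    have h4 := encard_insert_triple ha hb hc hba.ne.symm hac hbc.ne
    refine ⟨B, ?_, hFB, ?_⟩
    · refine (hmax B hB).resolve_right fun h3 => ?_
      have := Set.encard_le_encard hsub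
      rw [h3, h4] at this
      exact absurd this (by decide)
    · refine (Set.Finite.eq_of_subset_of_encard_le (Set.toFinite _) hsub ?_).symm
      rw [h4]
      exact hle B hB
  refine ⟨x, hx, ?_, ?_⟩
  · intro b a c d hb ha hc hd hba hbc hbd
    by_contra! hn
    obtain ⟨hac, had, hcd⟩ := hn
    have hconn : (G.induce ({d, a, b, c} : Set V)).Preconnected := by
      refine preconnected_induce_of_center (b := b) (by simp) ?_
      rintro v (rfl | rfl | rfl | rfl) hv <;> first | assumption | exact absurd rfl hv
    obtain ⟨B, hFB, hB⟩ := exists_maximal_twoConnected (isTwoConnected_fan hx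
      (by simp [hb.symm, ha.symm, hc.symm, hd.symm]) ⟨a, by simp, b, by simp, hba.ne.symm⟩ hconn)
    have hsub : ({x, d, a, b, c} : Set V) ⊆ B.verts := hFB.1
    have h5 := (Set.encard_le_encard hsub).trans (hle B hB)
    rw [Set.encard_insert_of_notMem (by simp [hb.symm, ha.symm, hc.symm, hd.symm]),
      encard_insert_triple had hbd.ne hcd hba.ne.symm hac hbc.ne] at h5
    exact absurd h5 (by decide)
  · intro b a c b' a' c' hb ha hc hb' ha' hc' hba hbc hac hba' hbc' hac'
    by_contra hbb
    obtain ⟨B, hB, hFB, hBv⟩ := htriple b a c hb ha hc hba hbc hac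
    obtain ⟨B', hB', hFB', hBv'⟩ := htriple b' a' c' hb' ha' hc' hba' hbc' hac'
    obtain rfl := hdia B B' hB hB'
    have hmem : ∀ v, v ∈ B.verts ↔ v = x ∨ v = a ∨ v = b ∨ v = c := fun v => by
      rw [hBv]; rfl
    have m1 := (hmem a').1 (by rw [hBv']; simp)
    have m2 := (hmem b').1 (by rw [hBv']; simp)
    have m3 := (hmem c').1 (by rw [hBv']; simp)
    -- Both centres lie in the same diamond, so `b'` is `a` or `c`, and its neighbours are the other
    -- two of `a`, `b`, `c`. The diamond would then be complete.
    have hac2 : G.Adj a c := by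
      have := hba'.ne
      have := hbc'.ne
      grind [SimpleGraph.Adj.symm]
    have hall : ∀ u ∈ B.verts, ∀ w ∈ B.verts, u ≠ w → B.Adj u w := by
      intro u hu w hw huw
      refine hFB.2 (fan_adj.2 ⟨by rwa [hBv] at hu, by rwa [hBv] at hw, ?_⟩)
      have hxa := hx a ha
      have hxb := hx b hb
      have hxc := hx c hc
      rcases (hmem u).1 hu with rfl | rfl | rfl | rfl <;>
        rcases (hmem w).1 hw with rfl | rfl | rfl | rfl <;>
        first
        | exact absurd rfl huw
        | assumption
        | exact SimpleGraph.Adj.symm (by assumption)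
    obtain ⟨e⟩ := hB.2
    have hne : e.symm 1 ≠ e.symm 3 := fun h => absurd (e.symm.injective h) (by decide)
    have h13 : B.coe.Adj (e.symm 1) (e.symm 3) :=
      hall _ (e.symm 1).2 _ (e.symm 3).2 fun h => hne (Subtype.ext h)
    rw [e.symm.map_adj_iff, diamond_adj] at h13
    exact h13.2.1 ⟨rfl, rfl⟩

end Blocks

/-! ### Joins that are m-decyclable. -/

section Join
variable {V : Type*} {G : SimpleGraph V}

/-- With a fifth vertex, every further edge or vertex is forbidden and `K_{2,3}` results. With four
vertices, `ab` and `cd` are not both edges: one gives the diamond, none the square. -/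
theorem IsMDecyclable.iso_of_join_pair (hG : IsMDecyclable G) {a b : V} (hab : a ≠ b)
    (hJ : ∀ v, v ≠ a → v ≠ b → G.Adj a v ∧ G.Adj b v) {c d : V} (hca : c ≠ a) (hcb : c ≠ b)
    (hda : d ≠ a) (hdb : d ≠ b) (hcd : c ≠ d) :
    Nonempty (G ≃g cycleGraph 4) ∨ Nonempty (G ≃g diamond) ∨
      Nonempty (G ≃g completeBipartiteGraph (Fin 2) (Fin 3)) := by
  obtain ⟨hac, hbc⟩ := hJ c hca hcb
  obtain ⟨had, hbd⟩ := hJ d hda hdb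
  by_cases he : ∃ e, e ≠ a ∧ e ≠ b ∧ e ≠ c ∧ e ≠ d
  · obtain ⟨e, hea, heb, hec, hed⟩ := he
    obtain ⟨hae, hbe⟩ := hJ e hea heb
    refine Or.inr (Or.inr (nonempty_iso_completeBipartite (a := a) (b := b) (c := c) (d := d)
      (e := e) ?_ ?_ hab ?_ hcd ?_ hec.symm ?_ hed.symm ?_ ?_))
    · simp [hac, had, hae]
    · simp [hbc, hbd, hbe]
    · intro h
      exact hG.no_book h hac had hae hbc hbd hbe hcd hec.symm hed.symm
    · intro h
      exact hG.no_two_three_add hac had hae hbc hbd hbe hab h hec.symm hed.symm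
    · intro h
      exact hG.no_two_three_add hac hae had hbc hbe hbd hab h hcd hed
    · intro h
      exact hG.no_two_three_add had hae hac hbd hbe hbc hab h hcd.symm hec
    · intro v
      by_contra! hv
      obtain ⟨hva, hvb, hvc, hvd, hve⟩ := hv
      obtain ⟨hav, hbv⟩ := hJ v hva hvb
      refine hG.no_two_four (a := c) (b := d) (c := e) (d := v) hab ?_ ?_ ?_
      · simp [hac, had, hae, hav]
      · simp [hbc, hbd, hbe, hbv]
      · simp [hcd, hec.symm, hvc.symm, hed.symm, hvd.symm, hve.symm]
  · have hcov : ∀ v, v = a ∨ v = b ∨ v = c ∨ v = d := by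
      intro v
      by_contra! hv
      exact he ⟨v, hv⟩
    by_cases hab' : G.Adj a b
    · refine Or.inr (Or.inl (nonempty_iso_diamond (a := a) (b := c) (c := b) (d := d) hac hab' had
        hbc.symm hbd hcd ?_ ?_))
      · exact fun h => hG.no_complete_four hab' hac had hbc hbd h
      · intro v
        have := hcov v
        tauto
    · by_cases hcd' : G.Adj c d
      · refine Or.inr (Or.inl (nonempty_iso_diamond (a := c) (b := a) (c := d) (d := b) hac.symm
          hcd' hbc.symm had hbd.symm hab hab' ?_))
        intro v
        have := hcov v
        tauto
      · refine Or.inl (nonempty_iso_cycle_four (a := a) (b := c) (c := b) (d := d) hac hbc.symm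
          hbd had.symm hab hab' hcd hcd' ?_)
        intro v
        have := hcov v
        tauto

theorem _root_.Set.Nontrivial.eq_pair_or_exists_three {S : Set V} (hS : S.Nontrivial) :
    (∃ a b, a ≠ b ∧ S = {a, b}) ∨
      ∃ a ∈ S, ∃ b ∈ S, ∃ c ∈ S, a ≠ b ∧ a ≠ c ∧ b ≠ c := by
  obtain ⟨a, ha, b, hb, hab⟩ := hS
  by_cases h : ∃ c ∈ S, a ≠ c ∧ b ≠ c
  · obtain ⟨c, hc, h⟩ := h
    exact Or.inr ⟨a, ha, b, hb, c, hc, hab, h⟩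
  · refine Or.inl ⟨a, b, hab, Set.Subset.antisymm ?_ ?_⟩
    · intro v hv
      simp only [Set.mem_insert_iff, Set.mem_singleton_iff]
      by_contra! hn
      exact h ⟨v, hv, hn.1.symm, hn.2.symm⟩
    · rintro v (rfl | rfl) <;> assumption

/-- Excluding `K_{3,3}` makes one side a pair; `aux` serves either side. -/
theorem IsMDecyclable.iso_of_join (hG : IsMDecyclable G) {A B : Set V} (hA : A.Nontrivial)
    (hB : B.Nontrivial) (hAB : ∀ v, v ∈ A ↔ v ∉ B) (hJ : ∀ a ∈ A, ∀ b ∈ B, G.Adj a b) :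
    Nonempty (G ≃g cycleGraph 4) ∨ Nonempty (G ≃g diamond) ∨
      Nonempty (G ≃g completeBipartiteGraph (Fin 2) (Fin 3)) := by
  have aux : ∀ A B : Set V, (∃ a b, a ≠ b ∧ A = {a, b}) → B.Nontrivial →
      (∀ v, v ∈ A ↔ v ∉ B) → (∀ a ∈ A, ∀ b ∈ B, G.Adj a b) →
      Nonempty (G ≃g cycleGraph 4) ∨ Nonempty (G ≃g diamond) ∨
        Nonempty (G ≃g completeBipartiteGraph (Fin 2) (Fin 3)) := by
    rintro _ B ⟨a, b, hab, rfl⟩ ⟨c, hc, d, hd, hcd⟩ hAB hJ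
    have hB : ∀ v, v ∈ B ↔ v ≠ a ∧ v ≠ b := by
      intro v
      have := hAB v
      simp only [Set.mem_insert_iff, Set.mem_singleton_iff] at this
      tauto
    have hc' := (hB c).1 hc
    have hd' := (hB d).1 hd
    refine hG.iso_of_join_pair hab (fun v h1 h2 => ?_) hc'.1 hc'.2 hd'.1 hd'.2 hcd
    have hv := (hB v).2 ⟨h1, h2⟩
    exact ⟨hJ a (by simp) v hv, hJ b (by simp) v hv⟩
  rcases hA.eq_pair_or_exists_three with h | ⟨a, ha, b, hb, c, hc, hab, hac, hbc⟩
  · exact aux A B h hB hAB hJ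
  rcases hB.eq_pair_or_exists_three with h | ⟨d, hd, e, he, f, hf, hde, hdf, hef⟩
  · refine aux B A h hA (fun v => ?_) fun u hu v hv => (hJ v hv u hu).symm
    have := hAB v
    tauto
  · exfalso
    have hne : ∀ u ∈ A, ∀ v ∈ B, u ≠ v := fun u hu v hv => (hJ u hu v hv).ne
    refine hG.no_three_three (a := a) (b := b) (c := c) (d := d) (e := e) (f := f) ?_ ?_ ?_ ?_
    · simp [hJ a ha d hd, hJ a ha e he, hJ a ha f hf]
    · simp [hJ b hb d hd, hJ b hb e he, hJ b hb f hf]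
    · simp [hJ c hc d hd, hJ c hc e he, hJ c hc f hf]
    · simp [hab, hac, hbc, hde, hdf, hef, hne a ha d hd, hne a ha e he, hne a ha f hf,
        hne b hb d hd, hne b hb e he, hne b hb f hf, hne c hc d hd, hne c hc e he, hne c hc f hf]

theorem IsHub.iso_of_not_isCutVertex [Nontrivial V] {x : V} (h : IsHub G x)
    (hconn : G.Connected) (hcut : ¬ IsCutVertex G x) :
    Nonempty (G ≃g completeGraph (Fin 2)) ∨ Nonempty (G ≃g completeGraph (Fin 3)) ∨
      Nonempty (G ≃g diamond) := by
  have hpre : (G.induce {y : V | y ≠ x}).Preconnected := by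
    by_contra hn
    exact hcut (isCutVertex_of_not_preconnected hconn hn)
  have hx : x ∉ {y : V | y ≠ x} := fun h => h rfl
  rcases h.eq_of_preconnected hx (exists_ne x) hpre with
    ⟨a, hS⟩ | ⟨a, b, hab, hS⟩ | ⟨a, b, c, hba, hbc, hac, hac', hS⟩
  · have hS' : ∀ v, v ≠ x ↔ v = a := fun v => Set.ext_iff.1 hS v
    refine Or.inl (nonempty_iso_two (h.adj a ((hS' a).2 rfl)) fun v => ?_)
    have := hS' v
    tauto
  · have hS' : ∀ v, v ≠ x ↔ v = a ∨ v = b := fun v => Set.ext_iff.1 hS v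
    refine Or.inr (Or.inl (nonempty_iso_three (h.adj a ((hS' a).2 (by simp)))
      (h.adj b ((hS' b).2 (by simp))) hab fun v => ?_))
    have := hS' v
    tauto
  · have hS' : ∀ v, v ≠ x ↔ v = a ∨ v = b ∨ v = c := fun v => Set.ext_iff.1 hS v
    refine Or.inr (Or.inr (nonempty_iso_diamond (h.adj a ((hS' a).2 (by simp)))
      (h.adj b ((hS' b).2 (by simp))) (h.adj c ((hS' c).2 (by simp))) hba.symm hbc hac hac'
      fun v => ?_))
    have := hS' v
    tauto

end Join
end MDecyclable

theorem mainTheorem8 {V : Type*} [Finite V] [Nontrivial V] (G : SimpleGraph V)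
    (hconn : G.Connected) (hG : MDecyclable.IsCograph G) :
    MDecyclable.IsMDecyclable G ↔
      (Nonempty (G ≃g SimpleGraph.completeGraph (Fin 2)) ∨
        Nonempty (G ≃g SimpleGraph.completeGraph (Fin 3)) ∨
        Nonempty (G ≃g SimpleGraph.cycleGraph 4) ∨
        Nonempty (G ≃g MDecyclable.diamond) ∨
        Nonempty (G ≃g completeBipartiteGraph (Fin 2) (Fin 3)) ∨
        MDecyclable.IsMDStar G) := by
  constructor
  · intro hM
    obtain ⟨A, hA, hB, hJ⟩ := hG.pathFree.exists_join hconn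
    -- The case of a join with a one-vertex side `x`, split by whether `x` is a cut vertex.
    have hub : ∀ x, (∀ v, v ≠ x → G.Adj x v) →
        Nonempty (G ≃g SimpleGraph.completeGraph (Fin 2)) ∨
        Nonempty (G ≃g SimpleGraph.completeGraph (Fin 3)) ∨
        Nonempty (G ≃g SimpleGraph.cycleGraph 4) ∨
        Nonempty (G ≃g MDecyclable.diamond) ∨
        Nonempty (G ≃g completeBipartiteGraph (Fin 2) (Fin 3)) ∨
        MDecyclable.IsMDStar G := by
      intro x hx
      by_cases hcut : MDecyclable.IsCutVertex G x
      · exact Or.inr (Or.inr (Or.inr (Or.inr (Or.inr ((hM.isHub hx).isMDStar hcut)))))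
      · have := (hM.isHub hx).iso_of_not_isCutVertex hconn hcut
        tauto
    rcases hA.exists_eq_singleton_or_nontrivial with ⟨x, rfl⟩ | hA'
    · exact hub x fun v hv => hJ x rfl v hv
    rcases hB.exists_eq_singleton_or_nontrivial with ⟨x, hBx⟩ | hB'
    · have hx : ∀ v, v ∉ A ↔ v = x := fun v => Set.ext_iff.1 hBx v
      refine hub x fun v hv => (hJ v ?_ x ((hx x).2 rfl)).symm
      by_contra hvA
      exact hv ((hx v).1 hvA)
    · have := hM.iso_of_join hA' hB' (fun v => by simp) fun a ha b hb => hJ a ha b hb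
      tauto
  · rintro (⟨⟨e⟩⟩ | ⟨⟨e⟩⟩ | ⟨⟨e⟩⟩ | ⟨⟨e⟩⟩ | ⟨⟨e⟩⟩ | h)
    · exact MDecyclable.isMDecyclable_complete_two.of_iso e
    · exact MDecyclable.isMDecyclable_complete_three.of_iso e
    · exact MDecyclable.isMDecyclable_cycle_four.of_iso e
    · exact MDecyclable.isMDecyclable_diamond.of_iso e
    · exact MDecyclable.isMDecyclable_completeBipartite.of_iso e
    · obtain ⟨x, hx⟩ := h.exists_isHub hconn hG.pathFree
      exact hx.isMDecyclable
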